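/- Let $r\ge 1$ and $n\ge r$ be integers and let $Y$ be a real $(r-1)\times n$ matrix with $Y=PH$, where $P$ is a real $(r-1)\times r$ matrix of full rank $r-1$ whose columns are affinely independent (so that they are the vertices of an $(r-1)$-dimensional simplex), and $H$ is a real $r\times n$ matrix that is column stochastic (entrywise nonnegative, every column summing to $1$) and satisfies the sufficiently scattered condition (SSC): (i) $\{x\in\mathbb R^r_{\ge 0} : e^\top x\ge \sqrt{r-1}\,\|x\|_2\}\subseteq \operatorname{cone}(H):=\{Hx : x\ge 0\}$, and (ii) the only real orthogonal $r\times r$ matrices $Q$ with $\operatorname{cone}(H)\subseteq\operatorname{cone}(Q)$ are permutation matrices. Here $e$ denotes an all-ones vector of the appropriate size and, for a matrix $M$, $\operatorname{conv}(M)$ denotes the convex hull of its columns. For $w\in\mathbb R^{r-1}$ put $$\mathcal V(w):=\sup\Big\{\operatorname{vol}(\operatorname{conv}(\Theta)) \;:\; \Theta\in\mathbb R^{(r-1)\times r},\ (Y-we^\top)^\top\Theta\le 1_{n\times r}\ \text{entrywise}\Big\}\in[0,\infty],$$ where $\operatorname{vol}$ is the Lebesgue measure on $\mathbb R^{r-1}$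 and $1_{n\times r}$ is the $n \times r$ all-ones matrix. Then: 1. $\mathcal V:\mathbb R^{r-1}\to[0,\infty]$ is convex, i.e. $\mathcal V(\lambda w_1+(1-\lambda)w_2)\le\lambda\mathcal V(w_1)+(1-\lambda)\mathcal V(w_2)$ for all $w_1,w_2\in\mathbb R^{r-1}$ and $\lambda\in[0,1]$ (with $0\cdot\infty=0$); 2. $\mathcal V(w)=\infty$ if and only if $w$ does not lie in the interior of $\operatorname{conv}(Y)$; 3. $\mathcal V$ has a unique minimum, at $v=Pe/r$: $\mathcal V(v)<\mathcal V(w)$ for every $w\in\mathbb R^{r-1}$ with $w\ne v$. -/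

import Mathlib

open scoped NNReal ENNReal Matrix

namespace DualVolume

/-- `conv(M)`: the convex hull of the columns of `M`. -/
def conv {m k : ℕ} (M : Matrix (Fin m) (Fin k) ℝ) : Set (Fin m → ℝ) :=
  convexHull ℝ (Set.range M.col)

/-- `cone(M) = {M x | x ≥ 0}`: the conic hull of the columns of `M`. -/
def cone {m k : ℕ} (M : Matrix (Fin m) (Fin k) ℝ) : Set (Fin m → ℝ) :=
  {y | ∃ x : Fin k → ℝ, (∀ i, 0 ≤ x i) ∧ y = M *ᵥ x}

/-- The second-order cone `{x ∈ ℝ₊^r | eᵀ x ≥ √(r - 1) ‖x‖₂}` (Euclidean norm). -/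
def secondOrderCone (r : ℕ) : Set (Fin r → ℝ) :=
  {x | (∀ i, 0 ≤ x i) ∧ √((r : ℝ) - 1) * ‖WithLp.toLp 2 x‖ ≤ ∑ i, x i}

/-- The sufficiently scattered condition. -/
structure SSC {r n : ℕ} (H : Matrix (Fin r) (Fin n) ℝ) : Prop where
  secondOrderCone_subset : secondOrderCone r ⊆ cone H
  eq_permMatrix : ∀ Q ∈ Matrix.orthogonalGroup (Fin r) ℝ, cone H ⊆ cone Q →
    ∃ σ : Equiv.Perm (Fin r), Q = σ.permMatrix ℝ

/-- Entrywise nonnegative with every column summing to one. -/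
structure ColumnStochastic {r n : ℕ} (H : Matrix (Fin r) (Fin n) ℝ) : Prop where
  nonneg : ∀ i j, 0 ≤ H i j
  sum_col : ∀ j, ∑ i, H i j = 1

/-- The constraint `(Y - w eᵀ)ᵀ Θ ≤ 1`, entrywise. -/
def Feasible {r n : ℕ} (Y : Matrix (Fin (r - 1)) (Fin n) ℝ) (w : Fin (r - 1) → ℝ)
    (Θ : Matrix (Fin (r - 1)) (Fin r) ℝ) : Prop :=
  ∀ (j : Fin n) (k : Fin r),
    ((Y - Matrix.vecMulVec w (1 : Fin n → ℝ))ᵀ * Θ : Matrix (Fin n) (Fin r) ℝ) j k ≤ 1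

/-- `V(w)`: the supremum, in `[0, ∞]`, of the Lebesgue volume of `conv(Θ)` over all real
`(r - 1) × r` matrices `Θ` with `(Y - w eᵀ)ᵀ Θ ≤ 1`. -/
noncomputable def V {r n : ℕ} (Y : Matrix (Fin (r - 1)) (Fin n) ℝ) (w : Fin (r - 1) → ℝ) :
    ℝ≥0∞ :=
  ⨆ (Θ : Matrix (Fin (r - 1)) (Fin r) ℝ) (_ : Feasible Y w Θ), MeasureTheory.volume (conv Θ)

end DualVolume

/-! Write `w = P *ᵥ ω` with `∑ ω i = 1` and replace `Θ` by the slack matrix `G i k = 1 - ⟨P_i - w,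
θ_k⟩`. Feasibility becomes `Gᵀ H ≥ 0` together with `ωᵀ G = 1`, and the volume becomes a fixed
finite positive multiple of `|det G|` (`exists_V_eq_mul_maxDet`), so `w` now enters only through the
normalisation by `ω`.

Infinity: off the interior, a supporting functional gives `d ≠ 0` with `dᵀ H ≥ 0` and `ωᵀ d ≤ 0`,
and moving a column along such a direction makes the determinant unbounded (`maxDet_eq_top`). In the
interior the feasible `Θ` are bounded.

Convexity: a `G` admissible at `a ω₁ + b ω₂` can be column-rescaled to be admissible at `ω₁` and at
`ω₂`; weighted AM-GM compares the scale factors (`maxDet_convex`).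

Minimum: at the barycentre, duality with the second-order cone bounds each column of `G` by `m` in
norm, so Hadamard gives `|det G| ≤ m ^ m`. At any other positive `ω`, the diagonal matrix of the `1
/ ω i` already exceeds this by strict AM-GM (`maxDet_center_lt`). -/

namespace DualVolume

open MeasureTheory

/-! ### Simplex volume as a determinant -/

/-- The matrix `M` with a row of ones added on top. -/
def homogenize {s m : ℕ} (M : Matrix (Fin s) (Fin m) ℝ) : Matrix (Fin (s + 1)) (Fin m) ℝ :=
  Matrix.of (Fin.cons 1 M)

@[simp]
theorem homogenize_zero {s m : ℕ} (M : Matrix (Fin s) (Fin m) ℝ) (k : Fin m) :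
    homogenize M 0 k = 1 := rfl

@[simp]
theorem homogenize_succ {s m : ℕ} (M : Matrix (Fin s) (Fin m) ℝ) (a : Fin s) (k : Fin m) :
    homogenize M a.succ k = M a k := rfl

/-- The edge vectors of the simplex with vertices the columns of `Θ`, issuing from the first one. -/
def edgeMatrix {s : ℕ} (Θ : Matrix (Fin s) (Fin (s + 1)) ℝ) : Matrix (Fin s) (Fin s) ℝ :=
  Matrix.of fun a k => Θ a k.succ - Θ a 0

theorem det_homogenize {s : ℕ} (Θ : Matrix (Fin s) (Fin (s + 1)) ℝ) :
    (homogenize Θ).det = (edgeMatrix Θ).det := by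
  have h : (homogenize Θ)ᵀ.det =
      (Matrix.of (Fin.cons ((homogenize Θ)ᵀ 0)
        fun k : Fin s => (homogenize Θ)ᵀ k.succ - (homogenize Θ)ᵀ 0) :
        Matrix (Fin (s + 1)) (Fin (s + 1)) ℝ).det := by
    refine Matrix.det_eq_of_forall_row_eq_smul_add_const (Fin.cons 0 1) 0 rfl fun i j => ?_
    refine Fin.cases ?_ (fun k => ?_) i <;> simp
  rw [← Matrix.det_transpose, h, Matrix.det_succ_column_zero, Fin.sum_univ_succ]
  simp only [Fin.val_zero, pow_zero, one_mul, Matrix.of_apply, Fin.cons_zero, Fin.cons_succ,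
    Matrix.transpose_apply, homogenize_zero, Pi.sub_apply, sub_self, mul_zero, zero_mul,
    Finset.sum_const_zero, add_zero]
  rw [← Matrix.det_transpose]
  congr 1

/-- The vertices `0, e₁, …, e_s` of the corner simplex. -/
def cornerVertex (s : ℕ) : Fin (s + 1) → Fin s → ℝ :=
  Fin.cons 0 fun k => Pi.single k 1

theorem affineSpan_cornerVertex (s : ℕ) :
    affineSpan ℝ (Set.range (cornerVertex s)) = ⊤ := by
  have h0 : (0 : Fin s → ℝ) ∈ affineSpan ℝ (Set.range (cornerVertex s)) :=
    subset_affineSpan ℝ _ ⟨0, rfl⟩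
  rw [← AffineSubspace.direction_eq_top_iff_of_nonempty ⟨0, h0⟩, eq_top_iff,
    ← (Pi.basisFun ℝ (Fin s)).span_eq, Submodule.span_le]
  rintro _ ⟨k, rfl⟩
  have hk : Pi.single k 1 ∈ affineSpan ℝ (Set.range (cornerVertex s)) :=
    subset_affineSpan ℝ _ ⟨k.succ, rfl⟩
  simpa using AffineSubspace.vsub_mem_direction hk h0

theorem volume_corner_ne_zero (s : ℕ) :
    volume (convexHull ℝ (Set.range (cornerVertex s))) ≠ 0 := by
  have h : (interior (convexHull ℝ (Set.range (cornerVertex s)))).Nonempty :=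
    interior_convexHull_nonempty_iff_affineSpan_eq_top.2 (affineSpan_cornerVertex s)
  exact (Measure.measure_pos_of_nonempty_interior _ h).ne'

theorem volume_corner_ne_top (s : ℕ) :
    volume (convexHull ℝ (Set.range (cornerVertex s))) ≠ ∞ :=
  ((Set.finite_range _).isCompact_convexHull ℝ).measure_ne_top

/-- The simplex is an affine image of the corner simplex, whose volume only needs to be nonzero and
finite. -/
theorem volume_conv {s : ℕ} (Θ : Matrix (Fin s) (Fin (s + 1)) ℝ) :
    volume (conv Θ) = volume (convexHull ℝ (Set.range (cornerVertex s))) *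
      ENNReal.ofReal |(homogenize Θ).det| := by
  have h : conv Θ = (fun x => Θ.col 0 + x) ''
      (Matrix.toLin' (edgeMatrix Θ) '' convexHull ℝ (Set.range (cornerVertex s))) := by
    rw [(Matrix.toLin' (edgeMatrix Θ)).isLinear.image_convexHull, ← Set.range_comp]
    have hv := convexHull_vadd (𝕜 := ℝ) (Θ.col 0)
      (Set.range (Matrix.toLin' (edgeMatrix Θ) ∘ cornerVertex s))
    simp only [← Set.image_vadd, vadd_eq_add] at hv
    rw [← hv, ← Set.range_comp, conv]
    congr 2
    funext k
    refine Fin.cases ?_ (fun j => ?_) k <;> ext a <;>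
      simp [cornerVertex, edgeMatrix, Matrix.col]
  rw [h, Set.image_add_left, measure_preimage_add]
  rw [Measure.addHaar_image_linearMap, LinearMap.det_toLin', det_homogenize, mul_comm]

/-! ### Passage to barycentric coordinates -/

theorem feasible_iff {s n : ℕ} {Y : Matrix (Fin s) (Fin n) ℝ} {w : Fin s → ℝ}
    {Θ : Matrix (Fin s) (Fin (s + 1)) ℝ} :
    Feasible (r := s + 1) Y w Θ ↔ ∀ j k, ∑ a, (Y a j - w a) * Θ a k ≤ 1 := by
  refine forall_congr' fun j => forall_congr' fun k => ?_
  have h : ((Y - Matrix.vecMulVec w (1 : Fin n → ℝ))ᵀ * Θ : Matrix (Fin n) (Fin (s + 1)) ℝ) j k =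
      ∑ a, (Y a j - w a) * Θ a k := by
    simp [Matrix.mul_apply]
  exact iff_of_eq (congrArg (· ≤ 1) h)

theorem V_eq_iSup {s n : ℕ} (Y : Matrix (Fin s) (Fin n) ℝ) (w : Fin s → ℝ) :
    V (r := s + 1) Y w = ⨆ (Θ : Matrix (Fin s) (Fin (s + 1)) ℝ)
      (_ : ∀ j k, ∑ a, (Y a j - w a) * Θ a k ≤ 1), volume (conv Θ) :=
  iSup_congr fun _ => iSup_congr_Prop feasible_iff fun _ => rfl

theorem det_homogenize_ne_zero {s : ℕ} {P : Matrix (Fin s) (Fin (s + 1)) ℝ}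
    (hP : AffineIndependent ℝ P.col) : (homogenize P).det ≠ 0 := by
  intro h
  obtain ⟨x, hx, hPx⟩ := Matrix.exists_mulVec_eq_zero_iff.2 h
  refine hx (funext fun i => affineIndependent_iff.1 hP Finset.univ x ?_ ?_ i (Finset.mem_univ i))
  · simpa [Matrix.mulVec, dotProduct] using congrFun hPx 0
  · ext a
    simpa [Matrix.mulVec, dotProduct, mul_comm] using congrFun hPx a.succ

/-- The involution `(t, x) ↦ (t + w ⬝ᵥ x, -x)`. -/
def shear {s : ℕ} (w : Fin s → ℝ) : Matrix (Fin (s + 1)) (Fin (s + 1)) ℝ :=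
  Matrix.of (Fin.cons (Fin.cons 1 w) fun a => Fin.cons 0 (-(1 : Matrix (Fin s) (Fin s) ℝ) a))

theorem shear_mul_zero {s m : ℕ} (w : Fin s → ℝ) (M : Matrix (Fin (s + 1)) (Fin m) ℝ) (k : Fin m) :
    (shear w * M) 0 k = M 0 k + ∑ a, w a * M a.succ k := by
  simp [Matrix.mul_apply, Fin.sum_univ_succ, shear]

theorem shear_mul_succ {s m : ℕ} (w : Fin s → ℝ) (M : Matrix (Fin (s + 1)) (Fin m) ℝ)
    (a : Fin s) (k : Fin m) : (shear w * M) a.succ k = -M a.succ k := by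
  simp [Matrix.mul_apply, Fin.sum_univ_succ, shear, Matrix.one_apply]

theorem shear_mul_shear_mul {s m : ℕ} (w : Fin s → ℝ) (M : Matrix (Fin (s + 1)) (Fin m) ℝ) :
    shear w * (shear w * M) = M := by
  ext i k
  refine Fin.cases ?_ (fun a => ?_) i
  · simp [shear_mul_zero, shear_mul_succ]
  · simp [shear_mul_succ]

theorem abs_det_shear {s : ℕ} (w : Fin s → ℝ) : |(shear w).det| = 1 := by
  have h := congrArg Matrix.det (shear_mul_shear_mul w 1)
  rw [mul_one, Matrix.det_mul, Matrix.det_one] at h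
  rcases mul_self_eq_one_iff.1 h with h | h <;> simp [h]

theorem transpose_homogenize_mul_shear_mul_apply {s m : ℕ} (P : Matrix (Fin s) (Fin (s + 1)) ℝ)
    (w : Fin s → ℝ) (Θ : Matrix (Fin s) (Fin m) ℝ) (i : Fin (s + 1)) (k : Fin m) :
    ((homogenize P)ᵀ * (shear w * homogenize Θ)) i k = 1 - ∑ a, (P a i - w a) * Θ a k := by
  rw [Matrix.mul_apply, Fin.sum_univ_succ]
  simp [shear_mul_zero, shear_mul_succ, sub_mul, Finset.sum_sub_distrib]
  ring

/-- Vectors of the dual cone of the columns of `H`, normalised by `ω`. -/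
def Admissible {m n : ℕ} (H : Matrix (Fin m) (Fin n) ℝ) (ω g : Fin m → ℝ) : Prop :=
  (∀ j, 0 ≤ ∑ i, g i * H i j) ∧ ∑ i, ω i * g i = 1

/-- The largest `|det G|` over square matrices `G` with admissible columns. -/
noncomputable def maxDet {m n : ℕ} (H : Matrix (Fin m) (Fin n) ℝ) (ω : Fin m → ℝ) : ℝ≥0∞ :=
  ⨆ (G : Matrix (Fin m) (Fin m) ℝ) (_ : ∀ k, Admissible H ω (G.col k)), ENNReal.ofReal |G.det|

theorem sum_sub_mul_of_barycentric {s : ℕ} {P : Matrix (Fin s) (Fin (s + 1)) ℝ}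
    (w u : Fin s → ℝ) (x : Fin (s + 1) → ℝ) (hx : ∑ i, x i = 1) :
    ∑ i, (1 - ∑ a, (P a i - w a) * u a) * x i = 1 - ∑ a, ((P *ᵥ x) a - w a) * u a := by
  simp only [sub_mul, one_mul, Finset.sum_sub_distrib, Finset.sum_mul, Matrix.mulVec, dotProduct,
    hx]
  congr 2
  · rw [Finset.sum_comm]
    exact Finset.sum_congr rfl fun _ _ => Finset.sum_congr rfl fun _ _ => by ring
  · rw [Finset.sum_comm]
    exact Finset.sum_congr rfl fun _ _ => by rw [← Finset.mul_sum, hx, mul_one]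

/-- The volumes of the simplices feasible at `P *ᵥ ω` in terms of the barycentric coordinates
`ω`. -/
theorem exists_V_eq_mul_maxDet {s n : ℕ} {P : Matrix (Fin s) (Fin (s + 1)) ℝ}
    (hP : AffineIndependent ℝ P.col) {H : Matrix (Fin (s + 1)) (Fin n) ℝ}
    (hH : ColumnStochastic H) :
    ∃ c : ℝ≥0∞, c ≠ 0 ∧ c ≠ ∞ ∧ ∀ ω : Fin (s + 1) → ℝ, ∑ i, ω i = 1 →
      V (r := s + 1) (P * H) (P *ᵥ ω) = c * maxDet H ω := by
  have hdet := det_homogenize_ne_zero hP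
  set c := volume (convexHull ℝ (Set.range (cornerVertex s))) with hc
  have hD : 0 < |(homogenize P).det| := abs_pos.2 hdet
  refine ⟨c * ENNReal.ofReal |(homogenize P).det|⁻¹,
    mul_ne_zero (volume_corner_ne_zero s) (by simpa using hdet),
    ENNReal.mul_ne_top (volume_corner_ne_top s) ENNReal.ofReal_ne_top, fun ω hω => ?_⟩
  set w := P *ᵥ ω with hw
  have key (Θ : Matrix (Fin s) (Fin (s + 1)) ℝ) : volume (conv Θ) =
      c * ENNReal.ofReal |(homogenize P).det|⁻¹ *
        ENNReal.ofReal |((homogenize P)ᵀ * (shear w * homogenize Θ)).det| := by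
    rw [volume_conv, Matrix.det_mul, Matrix.det_mul, abs_mul, abs_mul, abs_det_shear, one_mul,
      Matrix.det_transpose, mul_assoc, ← ENNReal.ofReal_mul (by positivity),
      inv_mul_cancel_left₀ hD.ne']
  have hfeas (Θ : Matrix (Fin s) (Fin (s + 1)) ℝ) (j : Fin n) (k : Fin (s + 1)) :
      ∑ i, ((homogenize P)ᵀ * (shear w * homogenize Θ)) i k * H i j =
        1 - ∑ a, ((P * H) a j - w a) * Θ a k := by
    simp only [transpose_homogenize_mul_shear_mul_apply]
    exact sum_sub_mul_of_barycentric w (fun a => Θ a k) (fun i => H i j) (hH.sum_col j)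
  rw [V_eq_iSup, maxDet]
  simp only [ENNReal.mul_iSup]
  refine le_antisymm (iSup₂_le fun Θ hΘ => ?_) (iSup₂_le fun G hG => ?_)
  · rw [key]
    refine le_iSup₂_of_le ((homogenize P)ᵀ * (shear w * homogenize Θ)) (fun k => ⟨fun j => ?_, ?_⟩)
      le_rfl
    · have := hfeas Θ j k
      simp only [Matrix.col_apply]
      linarith [hΘ j k]
    · simp only [Matrix.col_apply, transpose_homogenize_mul_shear_mul_apply, mul_comm (ω _)]
      rw [sum_sub_mul_of_barycentric w (fun a => Θ a k) ω hω]
      simp [hw]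
  -- Inverting the substitution: `ωᵀ G = 1` is exactly what makes the top row of `shear w * Z` all
  -- ones.
  · set Z := ((homogenize P)ᵀ)⁻¹ * G with hZ
    have hZG : (homogenize P)ᵀ * Z = G := by
      rw [hZ, Matrix.mul_nonsing_inv_cancel_left]
      simpa using hdet
    set Θ : Matrix (Fin s) (Fin (s + 1)) ℝ := Matrix.of fun a k => -Z a.succ k
    have hΘ : homogenize Θ = shear w * Z := by
      ext i k
      refine Fin.cases ?_ (fun a => ?_) i
      · have h1 : (homogenize P *ᵥ ω) ⬝ᵥ Z.col k = ω ⬝ᵥ G.col k := by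
          rw [← hZG, dotProduct_comm, Matrix.dotProduct_mulVec, dotProduct_comm,
            ← Matrix.mulVec_transpose]
          rfl
        have h2 : ω ⬝ᵥ G.col k = 1 := (hG k).2
        rw [h2, dotProduct, Fin.sum_univ_succ] at h1
        have h3 : (homogenize P *ᵥ ω) 0 = 1 := by simpa [Matrix.mulVec, dotProduct] using hω
        rw [h3, one_mul] at h1
        rw [shear_mul_zero, homogenize_zero]
        exact h1.symm
      · simp [shear_mul_succ, Θ]
    have hG' : (homogenize P)ᵀ * (shear w * homogenize Θ) = G := by
      rw [hΘ, shear_mul_shear_mul, hZG]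
    refine le_iSup₂_of_le Θ (fun j k => ?_) (by rw [key, hG'])
    have h1 := hfeas Θ j k
    have h2 := (hG k).1 j
    rw [hG'] at h1
    simp only [Matrix.col_apply] at h2
    linarith

theorem exists_barycentric {s : ℕ} {P : Matrix (Fin s) (Fin (s + 1)) ℝ}
    (hP : AffineIndependent ℝ P.col) (w : Fin s → ℝ) :
    ∃ ω : Fin (s + 1) → ℝ, ∑ i, ω i = 1 ∧ w = P *ᵥ ω := by
  have hu : IsUnit (homogenize P).det := (det_homogenize_ne_zero hP).isUnit
  have h : homogenize P *ᵥ ((homogenize P)⁻¹ *ᵥ Fin.cons 1 w) = Fin.cons 1 w := by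
    rw [Matrix.mulVec_mulVec, Matrix.mul_nonsing_inv _ hu, Matrix.one_mulVec]
  refine ⟨(homogenize P)⁻¹ *ᵥ Fin.cons 1 w, ?_, funext fun a => ?_⟩
  · simpa [Matrix.mulVec, dotProduct] using congrFun h 0
  · exact (congrFun h a.succ).symm

/-! ### Where the value is infinite -/

/-- Perturb the all-ones vector, which is admissible, to `1 + ε (e_k - ω_k 1)`, with `ε` small
enough that `ε ω_k ≤ 1`. -/
theorem exists_admissible_det_ne_zero {m n : ℕ} (hm : 0 < m) {H : Matrix (Fin m) (Fin n) ℝ}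
    (hH : ColumnStochastic H) {ω : Fin m → ℝ} (hω : ∑ i, ω i = 1) :
    ∃ G : Matrix (Fin m) (Fin m) ℝ, (∀ k, Admissible H ω (G.col k)) ∧ G.det ≠ 0 := by
  set ε : ℝ := (1 + ∑ i, |ω i|)⁻¹ with hε
  have hs : 0 ≤ ∑ i, |ω i| := Finset.sum_nonneg fun i _ => abs_nonneg _
  have hε0 : 0 < ε := by positivity
  have hεω (k) : ε * ω k ≤ 1 := by
    have h1 : ω k ≤ 1 + ∑ i, |ω i| := by
      have := Finset.single_le_sum (f := fun i => |ω i|) (fun i _ => abs_nonneg _)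
        (Finset.mem_univ k)
      linarith [le_abs_self (ω k)]
    rw [hε, inv_mul_le_iff₀ (by positivity)]
    linarith
  refine ⟨Matrix.of fun i k => 1 + ε * ((1 : Matrix (Fin m) (Fin m) ℝ) i k - ω k),
    fun k => ⟨fun j => ?_, ?_⟩, fun hdet => ?_⟩
  · have : ∑ i, (1 + ε * ((1 : Matrix (Fin m) (Fin m) ℝ) i k - ω k)) * H i j =
        (1 - ε * ω k) * ∑ i, H i j + ε * H k j := by
      simp only [Matrix.one_apply, add_mul, mul_sub, sub_mul, Finset.sum_add_distrib,
        Finset.sum_sub_distrib, Finset.mul_sum]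
      simp
      ring
    simp only [Matrix.col_apply, Matrix.of_apply]
    rw [this, hH.sum_col]
    have := mul_nonneg hε0.le (hH.nonneg k j)
    linarith [hεω k]
  · have : ∑ i, ω i * (1 + ε * ((1 : Matrix (Fin m) (Fin m) ℝ) i k - ω k)) =
        (1 - ε * ω k) * ∑ i, ω i + ε * ω k := by
      simp only [Matrix.one_apply, mul_add, mul_sub, sub_mul, Finset.sum_add_distrib,
        Finset.sum_sub_distrib, Finset.mul_sum]
      simp [mul_comm, mul_left_comm]
      ring
    simp only [Matrix.col_apply, Matrix.of_apply]
    rw [this, hω]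
    ring
  · obtain ⟨x, hx, hGx⟩ := Matrix.exists_mulVec_eq_zero_iff.2 hdet
    have h (i) : ∑ k, x k + ε * x i - ε * ∑ k, ω k * x k = 0 := by
      have := congrFun hGx i
      simp only [Matrix.mulVec, dotProduct, Matrix.of_apply, Matrix.one_apply, Pi.zero_apply,
        add_mul, mul_sub, sub_mul, Finset.sum_add_distrib, Finset.sum_sub_distrib, one_mul] at this
      rw [← this, Finset.mul_sum]
      simp [mul_assoc]
      ring
    set c := ε⁻¹ * (ε * ∑ k, ω k * x k - ∑ k, x k)
    have hc (i) : x i = c := by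
      rw [eq_inv_mul_iff_mul_eq₀ hε0.ne']
      linarith [h i]
    have h0 := h ⟨0, hm⟩
    simp only [hc, ← Finset.sum_mul, hω] at h0
    simp only [Finset.sum_const, Finset.card_univ, Fintype.card_fin, nsmul_eq_mul] at h0
    have hm' : (m : ℝ) ≠ 0 := by positivity
    have hc0 : c = 0 := by
      have : (m : ℝ) * c = 0 := by linarith
      simpa [hm'] using this
    exact hx (funext fun i => (hc i).trans hc0)

/-- Adding `t • d` to column `k` keeps it admissible and changes the determinant affinely with slope
`G.cramer d k`. Some slope is nonzero because `G *ᵥ G.cramer d = G.det • d`. -/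
theorem maxDet_eq_top_of_sum_eq_zero {m n : ℕ} (hm : 0 < m) {H : Matrix (Fin m) (Fin n) ℝ}
    (hH : ColumnStochastic H) {ω : Fin m → ℝ} (hω : ∑ i, ω i = 1) {d : Fin m → ℝ} (hd : d ≠ 0)
    (hdH : ∀ j, 0 ≤ ∑ i, d i * H i j) (hdω : ∑ i, ω i * d i = 0) :
    maxDet H ω = ∞ := by
  obtain ⟨G, hG, hdet⟩ := exists_admissible_det_ne_zero hm hH hω
  obtain ⟨k, hk⟩ : ∃ k, G.cramer d k ≠ 0 := by
    by_contra! h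
    have h1 := Matrix.mulVec_cramer G d
    rw [show G.cramer d = 0 from funext h, Matrix.mulVec_zero] at h1
    exact (smul_ne_zero hdet hd) h1.symm
  refine ENNReal.eq_top_of_forall_nnreal_le fun R => ?_
  have hB : 0 < |G.cramer d k| := abs_pos.2 hk
  set t := (R + |G.det|) / |G.cramer d k| with ht
  have ht0 : 0 ≤ t := by positivity
  have hdet' : (G.updateCol k (G.col k + t • d)).det = G.det + t * G.cramer d k := by
    rw [Matrix.det_updateCol_add, Matrix.det_updateCol_smul, Matrix.cramer_apply]
    congr 2
    exact Matrix.updateCol_eq_self G k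
  refine le_iSup₂_of_le (G.updateCol k (G.col k + t • d)) (fun l => ?_) ?_
  · by_cases hl : l = k
    · subst hl
      have : (G.updateCol l (G.col l + t • d)).col l = G.col l + t • d := by ext i; simp
      rw [this]
      refine ⟨fun j => ?_, ?_⟩
      · have h1 := (hG l).1 j
        have h2 := mul_nonneg ht0 (hdH j)
        simp only [Pi.add_apply, Pi.smul_apply, smul_eq_mul, add_mul, Finset.sum_add_distrib,
          mul_assoc, ← Finset.mul_sum]
        linarith
      · have h1 := (hG l).2
        simp only [Pi.add_apply, Pi.smul_apply, smul_eq_mul, mul_add, Finset.sum_add_distrib,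
          mul_left_comm _ t, ← Finset.mul_sum, h1, hdω]
        ring
    · have : (G.updateCol k (G.col k + t • d)).col l = G.col l := by ext i; simp [hl]
      rw [this]
      exact hG l
  · rw [hdet', ← ENNReal.ofReal_coe_nnreal]
    refine ENNReal.ofReal_le_ofReal ?_
    have h1 : t * |G.cramer d k| = R + |G.det| := div_mul_cancel₀ _ hB.ne'
    have h2 := abs_sub_abs_le_abs_sub (t * G.cramer d k) (-G.det)
    rw [abs_mul, abs_of_nonneg ht0, h1, abs_neg, sub_neg_eq_add, add_comm (t * _)] at h2
    linarith

/-- Subtracting the constant `c = ∑ ω i * d i ≤ 0` from `d` makes its pairing with `ω` vanish and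
only raises its pairings with the columns of `H`. -/
theorem maxDet_eq_top {m n : ℕ} (hm : 0 < m) (hn : 0 < n) {H : Matrix (Fin m) (Fin n) ℝ}
    (hH : ColumnStochastic H) {ω : Fin m → ℝ} (hω : ∑ i, ω i = 1) {d : Fin m → ℝ} (hd : d ≠ 0)
    (hdH : ∀ j, 0 ≤ ∑ i, d i * H i j) (hdω : ∑ i, ω i * d i ≤ 0) :
    maxDet H ω = ∞ := by
  set c := ∑ i, ω i * d i with hc
  have hsum (j) : ∑ i, (d i - c) * H i j = ∑ i, d i * H i j - c := by
    simp only [sub_mul, Finset.sum_sub_distrib, ← Finset.mul_sum, hH.sum_col, mul_one]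
  refine maxDet_eq_top_of_sum_eq_zero hm hH hω (d := fun i => d i - c) (fun h => hd ?_)
    (fun j => ?_) ?_
  · have hdc (i) : d i = c := sub_eq_zero.1 (congrFun h i)
    have h1 := hdH ⟨0, hn⟩
    simp only [hdc, ← Finset.mul_sum, hH.sum_col, mul_one] at h1
    exact funext fun i => (hdc i).trans (le_antisymm hdω h1)
  · rw [hsum]
    linarith [hdH j]
  · simp only [mul_sub, Finset.sum_sub_distrib, ← Finset.sum_mul, hω]
    rw [← hc]
    ring

theorem exists_supporting_functional {s n : ℕ} (hn : 0 < n) {Y : Matrix (Fin s) (Fin n) ℝ}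
    {w : Fin s → ℝ} (hw : w ∉ interior (conv Y)) :
    ∃ f : (Fin s → ℝ) →ₗ[ℝ] ℝ, f ≠ 0 ∧ ∀ j, f (Y.col j) ≤ f w := by
  by_cases hint : (interior (conv Y)).Nonempty
  · obtain ⟨f, hf, hfY⟩ :=
      geometric_hahn_banach_of_nonempty_interior_point (convex_convexHull ℝ _) hw hint
    refine ⟨f, fun h => hf (ContinuousLinearMap.coe_injective h), fun j => ?_⟩
    exact hfY _ (subset_convexHull ℝ _ ⟨j, rfl⟩)
  -- The columns lie in a proper affine subspace: take a functional constant on it, with the sign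
  -- chosen to suit `w`.
  · rw [conv, interior_convexHull_nonempty_iff_affineSpan_eq_top] at hint
    have hj0 : Y.col ⟨0, hn⟩ ∈ affineSpan ℝ (Set.range Y.col) :=
      subset_affineSpan ℝ _ ⟨_, rfl⟩
    rw [← AffineSubspace.direction_eq_top_iff_of_nonempty ⟨_, hj0⟩] at hint
    obtain ⟨f, hf, hker⟩ := Submodule.exists_le_ker_of_lt_top _ (lt_top_iff_ne_top.2 hint)
    have hconst (j) : f (Y.col j) = f (Y.col ⟨0, hn⟩) := by
      have h1 : Y.col j ∈ affineSpan ℝ (Set.range Y.col) := subset_affineSpan ℝ _ ⟨_, rfl⟩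
      have h2 := hker (AffineSubspace.vsub_mem_direction h1 hj0)
      rwa [LinearMap.mem_ker, vsub_eq_sub, map_sub, sub_eq_zero] at h2
    rcases le_total (f (Y.col ⟨0, hn⟩)) (f w) with h | h
    · exact ⟨f, hf, fun j => (hconst j).trans_le h⟩
    · exact ⟨-f, neg_ne_zero.2 hf, fun j => by simpa [hconst j] using h⟩

theorem exists_recession_of_notMem_interior {s n : ℕ} (hn : 0 < n)
    {P : Matrix (Fin s) (Fin (s + 1)) ℝ} (hP : AffineIndependent ℝ P.col)
    {H : Matrix (Fin (s + 1)) (Fin n) ℝ} (hH : ColumnStochastic H) {ω : Fin (s + 1) → ℝ}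
    (hω : ∑ i, ω i = 1) (hw : P *ᵥ ω ∉ interior (conv (P * H))) :
    ∃ d : Fin (s + 1) → ℝ, d ≠ 0 ∧ (∀ j, 0 ≤ ∑ i, d i * H i j) ∧ ∑ i, ω i * d i ≤ 0 := by
  obtain ⟨f, hf, hfY⟩ := exists_supporting_functional hn hw
  have hfP (x : Fin (s + 1) → ℝ) : f (P *ᵥ x) = ∑ i, f (P.col i) * x i := by
    rw [Matrix.mulVec_eq_sum, map_sum]
    refine Finset.sum_congr rfl fun i _ => ?_
    rw [op_smul_eq_smul, map_smul, smul_eq_mul, mul_comm]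
    rfl
  have hsum (x : Fin (s + 1) → ℝ) (hx : ∑ i, x i = 1) :
      ∑ i, (f (P *ᵥ ω) - f (P.col i)) * x i = f (P *ᵥ ω) - f (P *ᵥ x) := by
    rw [hfP x]
    simp only [sub_mul, Finset.sum_sub_distrib, ← Finset.mul_sum, hx, mul_one]
  -- If these differences all vanished, `f` would be constant on the affine span of the columns of
  -- `P`, which is the whole space.
  refine ⟨fun i => f (P *ᵥ ω) - f (P.col i), fun h => hf ?_, fun j => ?_, ?_⟩
  · ext1 a
    have hconst (x : Fin (s + 1) → ℝ) (hx : ∑ i, x i = 1) : f (P *ᵥ x) = f (P *ᵥ ω) := by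
      have h1 := hsum x hx
      have h2 (i) : f (P *ᵥ ω) - f (P.col i) = 0 := congrFun h i
      simp only [h2, zero_mul, Finset.sum_const_zero] at h1
      linarith
    ext
    obtain ⟨x, hx, hxe⟩ := exists_barycentric hP (Pi.single a 1)
    obtain ⟨y, hy, hye⟩ := exists_barycentric hP 0
    have h1 := (hconst x hx).trans (hconst y hy).symm
    rw [← hxe, ← hye, map_zero] at h1
    simpa using h1
  · rw [hsum _ (hH.sum_col j)]
    exact sub_nonneg.2 (hfY j)
  · simp only [mul_comm (ω _)]
    rw [hsum ω hω, sub_self]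

/-- The constraints extend to all of `conv Y`, hence to a `δ`-ball about `w`; testing at `w ± δ e_a`
bounds each entry of `Θ` by `δ⁻¹`. -/
theorem V_ne_top_of_mem_interior {s n : ℕ} {Y : Matrix (Fin s) (Fin n) ℝ} {w : Fin s → ℝ}
    (hw : w ∈ interior (conv Y)) : V (r := s + 1) Y w ≠ ∞ := by
  obtain ⟨δ, hδ, hball⟩ := Metric.nhds_basis_closedBall.mem_iff.1 (mem_interior_iff_mem_nhds.1 hw)
  refine ne_top_of_le_ne_top
    (measure_closedBall_lt_top (μ := volume) (x := (0 : Fin s → ℝ)) (r := δ⁻¹)).ne ?_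
  rw [V_eq_iSup]
  refine iSup₂_le fun Θ hΘ => measure_mono (convexHull_min ?_ (convex_closedBall _ _))
  rintro _ ⟨k, rfl⟩
  have hle : ∀ x ∈ conv Y, ∑ a, (x a - w a) * Θ a k ≤ 1 := by
    have hconv : Convex ℝ {x : Fin s → ℝ | ∑ a, x a * Θ a k ≤ 1 + ∑ a, w a * Θ a k} :=
      convex_halfSpace_le
        (f := fun x : Fin s → ℝ => ∑ a, x a * Θ a k)
        ⟨fun x y => by simp [add_mul, Finset.sum_add_distrib],
          fun c x => by simp [Finset.mul_sum, mul_assoc]⟩ _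
    intro x hx
    have : x ∈ {x : Fin s → ℝ | ∑ a, x a * Θ a k ≤ 1 + ∑ a, w a * Θ a k} := by
      refine convexHull_min ?_ hconv hx
      rintro _ ⟨j, rfl⟩
      have := hΘ j k
      simp only [sub_mul, Finset.sum_sub_distrib] at this
      simp only [Set.mem_ofPred_eq, Matrix.col_apply]
      linarith
    simp only [Set.mem_ofPred_eq] at this
    simp only [sub_mul, Finset.sum_sub_distrib]
    linarith
  have hcoord (a : Fin s) (c : ℝ) (hc : |c| = δ) : c * Θ a k ≤ 1 := by
    have h := hle (w + Pi.single a c) (hball (by simp [Pi.norm_single, hc]))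
    simpa [Pi.single_apply] using h
  rw [mem_closedBall_zero_iff, pi_norm_le_iff_of_nonneg (by positivity)]
  intro a
  have h1 := hcoord a δ (abs_of_pos hδ)
  have h2 := hcoord a (-δ) (by rw [abs_neg, abs_of_pos hδ])
  rw [Real.norm_eq_abs, ← one_div, le_div_iff₀ hδ, Matrix.col_apply]
  rcases abs_cases (Θ a k) with ⟨h, _⟩ | ⟨h, _⟩ <;> rw [h] <;> linarith

/-! ### Convexity -/

theorem le_maxDet_of_pos {m n : ℕ} {H : Matrix (Fin m) (Fin n) ℝ} {ω : Fin m → ℝ}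
    {G : Matrix (Fin m) (Fin m) ℝ} (hG : ∀ k j, 0 ≤ ∑ i, G i k * H i j)
    (hω : ∀ k, 0 < ∑ i, ω i * G i k) :
    ENNReal.ofReal (|G.det| * ∏ k, (∑ i, ω i * G i k)⁻¹) ≤ maxDet H ω := by
  refine le_iSup₂_of_le (G * Matrix.diagonal fun k => (∑ i, ω i * G i k)⁻¹)
    (fun k => ⟨fun j => ?_, ?_⟩) ?_
  · simp only [Matrix.col_apply, Matrix.mul_diagonal, mul_right_comm, ← Finset.sum_mul]
    exact mul_nonneg (hG k j) (inv_nonneg.2 (hω k).le)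
  · simp only [Matrix.col_apply, Matrix.mul_diagonal, ← mul_assoc, ← Finset.sum_mul]
    exact mul_inv_cancel₀ (hω k).ne'
  · rw [Matrix.det_mul, Matrix.det_diagonal, abs_mul, Finset.abs_prod]
    refine ENNReal.ofReal_le_ofReal (le_of_eq ?_)
    congr 1
    exact Finset.prod_congr rfl fun k _ => (abs_of_pos (inv_pos.2 (hω k))).symm

/-- Weighted AM-GM twice: on the two products, then on each pair, where `p k ^ a * q k ^ b ≤ a * p k
+ b * q k = 1`. -/
theorem one_le_weighted_prod_inv {ι : Type*} [Fintype ι] {a b : ℝ} (ha : 0 ≤ a) (hb : 0 ≤ b)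
    (hab : a + b = 1) {p q : ι → ℝ} (hp : ∀ k, 0 < p k) (hq : ∀ k, 0 < q k)
    (hpq : ∀ k, a * p k + b * q k = 1) :
    1 ≤ a * ∏ k, (p k)⁻¹ + b * ∏ k, (q k)⁻¹ := by
  have hP : 0 < ∏ k, (p k)⁻¹ := Finset.prod_pos fun k _ => inv_pos.2 (hp k)
  have hQ : 0 < ∏ k, (q k)⁻¹ := Finset.prod_pos fun k _ => inv_pos.2 (hq k)
  refine le_trans ?_ (Real.geom_mean_le_arith_mean2_weighted ha hb hP.le hQ.le hab)
  rw [← Real.finsetProd_rpow _ _ fun k _ => (inv_pos.2 (hp k)).le,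
    ← Real.finsetProd_rpow _ _ fun k _ => (inv_pos.2 (hq k)).le, ← Finset.prod_mul_distrib]
  refine Finset.one_le_prod fun k _ => ?_
  rw [Real.inv_rpow (hp k).le, Real.inv_rpow (hq k).le, ← mul_inv]
  refine (one_le_inv₀ (mul_pos (Real.rpow_pos_of_pos (hp k) _) (Real.rpow_pos_of_pos (hq k) _))).2 ?_
  exact (Real.geom_mean_le_arith_mean2_weighted ha hb (hp k).le (hq k).le hab).trans_eq (hpq k)

theorem maxDet_convex {m n : ℕ} (hm : 0 < m) (hn : 0 < n) {H : Matrix (Fin m) (Fin n) ℝ}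
    (hH : ColumnStochastic H) {ω₁ ω₂ : Fin m → ℝ} (hω₁ : ∑ i, ω₁ i = 1) (hω₂ : ∑ i, ω₂ i = 1)
    {a b : ℝ≥0} (hab : a + b = 1) :
    maxDet H ((a : ℝ) • ω₁ + (b : ℝ) • ω₂) ≤ a * maxDet H ω₁ + b * maxDet H ω₂ := by
  rcases eq_or_ne a 0 with rfl | ha
  · obtain rfl : b = 1 := by simpa using hab
    simp
  rcases eq_or_ne b 0 with rfl | hb
  · obtain rfl : a = 1 := by simpa using hab
    simp
  by_cases h₁ : maxDet H ω₁ = ∞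
  · simp [h₁, ENNReal.mul_top, ha]
  by_cases h₂ : maxDet H ω₂ = ∞
  · simp [h₂, ENNReal.mul_top, hb]
  refine iSup₂_le fun G hG => ?_
  have hne (k) : G.col k ≠ 0 := fun h => by
    have h1 := (hG k).2
    rw [h] at h1
    simp at h1
  -- A nonpositive pairing would make the column itself a direction forcing the value `∞` at `ω₁`.
  have hp (k) : 0 < ∑ i, ω₁ i * G i k := by
    by_contra! h
    exact h₁ (maxDet_eq_top hm hn hH hω₁ (hne k) (hG k).1 h)
  have hq (k) : 0 < ∑ i, ω₂ i * G i k := by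
    by_contra! h
    exact h₂ (maxDet_eq_top hm hn hH hω₂ (hne k) (hG k).1 h)
  have hpq (k) : (a : ℝ) * ∑ i, ω₁ i * G i k + b * ∑ i, ω₂ i * G i k = 1 := by
    rw [← (hG k).2]
    simp [add_mul, Finset.sum_add_distrib, Finset.mul_sum, mul_assoc]
  have h := one_le_weighted_prod_inv a.coe_nonneg b.coe_nonneg
    (by rw [← NNReal.coe_add, hab, NNReal.coe_one]) hp hq hpq
  calc ENNReal.ofReal |G.det|
      ≤ ENNReal.ofReal (a * (|G.det| * ∏ k, (∑ i, ω₁ i * G i k)⁻¹) +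
          b * (|G.det| * ∏ k, (∑ i, ω₂ i * G i k)⁻¹)) := by
        refine ENNReal.ofReal_le_ofReal ?_
        have := mul_le_mul_of_nonneg_left h (abs_nonneg G.det)
        linarith
    _ ≤ ENNReal.ofReal (a * (|G.det| * ∏ k, (∑ i, ω₁ i * G i k)⁻¹)) +
          ENNReal.ofReal (b * (|G.det| * ∏ k, (∑ i, ω₂ i * G i k)⁻¹)) := ENNReal.ofReal_add_le
    _ ≤ a * maxDet H ω₁ + b * maxDet H ω₂ := by
        rw [ENNReal.ofReal_mul a.coe_nonneg, ENNReal.ofReal_mul b.coe_nonneg, ENNReal.ofReal_coe_nnreal,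
          ENNReal.ofReal_coe_nnreal]
        gcongr
        · exact le_maxDet_of_pos (fun k j => (hG k).1 j) hp
        · exact le_maxDet_of_pos (fun k j => (hG k).1 j) hq

/-! ### The minimum at the barycentre -/

theorem abs_det_le_prod_norm_col {m : ℕ} (G : Matrix (Fin m) (Fin m) ℝ) :
    |G.det| ≤ ∏ k, ‖WithLp.toLp 2 (G.col k)‖ := by
  have : Fact (Module.finrank ℝ (EuclideanSpace ℝ (Fin m)) = m) := ⟨by simp⟩
  let b := EuclideanSpace.basisFun (Fin m) ℝ
  have h := b.toBasis.orientation.abs_volumeForm_apply_le fun k => WithLp.toLp 2 (G.col k)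
  rw [b.toBasis.orientation.volumeForm_robust b rfl, Module.Basis.det_apply] at h
  convert h using 3
  ext i k
  simp [b, Module.Basis.toMatrix_apply]

/-- Cauchy-Schwarz on the other `m - 1` entries, which sum to `-p i`. -/
theorem mul_sq_le_of_sum_eq_zero {m : ℕ} {p : Fin m → ℝ} (hp : ∑ i, p i = 0) (i : Fin m) :
    m * p i ^ 2 ≤ (m - 1) * ∑ k, p k ^ 2 := by
  have h := sq_sum_le_card_mul_sum_sq (s := Finset.univ.erase i) (f := p)
  rw [Finset.card_erase_of_mem (Finset.mem_univ i), Finset.card_univ, Fintype.card_fin,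
    Nat.cast_sub (Fin.pos i), Nat.cast_one] at h
  have h1 := Finset.add_sum_erase Finset.univ p (Finset.mem_univ i)
  have h2 := Finset.add_sum_erase Finset.univ (fun k => p k ^ 2) (Finset.mem_univ i)
  rw [show ∑ k ∈ Finset.univ.erase i, p k = -p i by linarith] at h
  rw [← h2]
  linarith

/-- Vectors of the dual of the second-order cone with coordinate sum `m` have norm at most `m`. -/
theorem sum_sq_le_of_dual {m : ℕ} (hm : 0 < m) {g : Fin m → ℝ} (hg : ∑ i, g i = m)
    (hdual : ∀ x ∈ secondOrderCone m, 0 ≤ ∑ i, g i * x i) : ∑ i, g i ^ 2 ≤ (m : ℝ) ^ 2 := by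
  have hm1 : (1 : ℝ) ≤ m := by exact_mod_cast hm
  set p : Fin m → ℝ := fun i => g i - 1 with hp
  have hp0 : ∑ i, p i = 0 := by simp [hp, hg]
  have hgp : ∑ i, g i ^ 2 = m + ∑ i, p i ^ 2 := by
    have h (i) : g i ^ 2 = 2 * g i - 1 + p i ^ 2 := by simp only [hp]; ring
    simp only [h, Finset.sum_add_distrib, Finset.sum_sub_distrib, ← Finset.mul_sum, hg]
    simp
    ring
  set N := ∑ i, p i ^ 2 with hN
  have hN0 : 0 ≤ N := Finset.sum_nonneg fun i _ => sq_nonneg _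
  -- Chosen so that the test vector `α 1 - p` meets the norm inequality of the cone with equality.
  -- Pairing it with `g` gives `N ≤ m α`, whence `N ≤ m (m - 1)`.
  set α := √((m - 1) * N / m) with hα
  have hαsq : α ^ 2 * m = (m - 1) * N := by
    rw [hα, Real.sq_sqrt (div_nonneg (mul_nonneg (by linarith) hN0) (by linarith))]
    field_simp
  have hα0 : 0 ≤ α := Real.sqrt_nonneg _
  have hsum : ∑ i, (α - p i) = m * α := by simp [Finset.sum_sub_distrib, hp0]
  have hmem : (fun i => α - p i) ∈ secondOrderCone m := by
    refine ⟨fun i => sub_nonneg.2 (abs_le_of_sq_le_sq' ?_ hα0).2, ?_⟩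
    · have := mul_sq_le_of_sum_eq_zero hp0 i
      nlinarith
    · rw [hsum, EuclideanSpace.norm_eq, ← Real.sqrt_mul (by linarith)]
      refine Real.sqrt_le_iff.2 ⟨by positivity, ?_⟩
      have h : ∑ i, ‖WithLp.toLp 2 (fun i => α - p i) i‖ ^ 2 = m * α ^ 2 + N := by
        have h (i) : (α - p i) ^ 2 = α ^ 2 - 2 * α * p i + p i ^ 2 := by ring
        simp only [Real.norm_eq_abs, sq_abs, h, Finset.sum_add_distrib, Finset.sum_sub_distrib,
          ← Finset.mul_sum, hp0]
        simp [hN]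
      rw [h]
      nlinarith
  have h0 := hdual _ hmem
  have hip : ∑ i, g i * (α - p i) = m * α - N := by
    have h (i) : g i * (α - p i) = (α - p i) + α * p i - p i ^ 2 := by simp only [hp]; ring
    simp only [h, Finset.sum_add_distrib, Finset.sum_sub_distrib (f := fun i => _ + _), hsum,
      ← Finset.mul_sum, hp0]
    ring
  rw [hip] at h0
  have hNN : N * N ≤ N * (m * (m - 1)) := by
    have : N ^ 2 ≤ (m * α) ^ 2 := by gcongr; linarith
    nlinarith
  have hNle : N ≤ m * (m - 1) := by
    rcases hN0.eq_or_lt with h | h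
    · rw [← h]; exact mul_nonneg (by linarith) (by linarith)
    · exact le_of_mul_le_mul_left hNN h
  rw [hgp]
  nlinarith

theorem maxDet_center_le {m n : ℕ} (hm : 0 < m) {H : Matrix (Fin m) (Fin n) ℝ}
    (hH : secondOrderCone m ⊆ cone H) :
    maxDet H ((m : ℝ)⁻¹ • 1) ≤ ENNReal.ofReal ((m : ℝ) ^ m) := by
  have hm0 : (m : ℝ) ≠ 0 := by positivity
  refine iSup₂_le fun G hG => ENNReal.ofReal_le_ofReal ((abs_det_le_prod_norm_col G).trans ?_)
  have hcol (k) : ‖WithLp.toLp 2 (G.col k)‖ ≤ m := by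
    rw [EuclideanSpace.norm_eq]
    refine Real.sqrt_le_iff.2 ⟨by positivity, ?_⟩
    simp only [Real.norm_eq_abs, sq_abs]
    refine sum_sq_le_of_dual hm ?_ fun x hx => ?_
    · have := (hG k).2
      simp only [Pi.smul_apply, Pi.one_apply, smul_eq_mul, mul_one, ← Finset.mul_sum] at this
      rwa [inv_mul_eq_iff_eq_mul₀ hm0, mul_one] at this
    · obtain ⟨y, hy, rfl⟩ := hH hx
      simp only [Matrix.mulVec, dotProduct, Finset.mul_sum]
      rw [Finset.sum_comm]
      refine Finset.sum_nonneg fun j _ => ?_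
      simp only [← mul_assoc, ← Finset.sum_mul]
      exact mul_nonneg ((hG k).1 j) (hy j)
  calc ∏ k, ‖WithLp.toLp 2 (G.col k)‖ ≤ ∏ _k : Fin m, (m : ℝ) :=
        Finset.prod_le_prod (fun _ _ => norm_nonneg _) fun k _ => hcol k
    _ = (m : ℝ) ^ m := by simp

theorem prod_lt_of_sum_eq_one {m : ℕ} (hm : 0 < m) {ω : Fin m → ℝ} (hω : ∑ i, ω i = 1)
    (hpos : ∀ i, 0 < ω i) (hne : ω ≠ (m : ℝ)⁻¹ • 1) : ∏ i, ω i < ((m : ℝ)⁻¹) ^ m := by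
  have hm0 : (m : ℝ) ≠ 0 := by positivity
  have hmean : ∑ i, (m : ℝ)⁻¹ * ω i = (m : ℝ)⁻¹ := by rw [← Finset.mul_sum, hω, mul_one]
  have h := (Real.geom_mean_lt_arith_mean_weighted_iff_of_pos' Finset.univ (fun _ => (m : ℝ)⁻¹) ω
    (fun _ _ => by positivity) (by simp [hm0]) fun i _ => (hpos i).le).2 (by
      obtain ⟨j, hj⟩ := Function.ne_iff.1 hne
      exact ⟨j, Finset.mem_univ j, by simpa [hmean] using hj⟩)
  rw [hmean] at h
  have h2 := pow_lt_pow_left₀ h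
    (Finset.prod_nonneg fun i _ => Real.rpow_nonneg (hpos i).le _) hm.ne'
  rw [← Finset.prod_pow] at h2
  simpa only [Real.rpow_inv_natCast_pow (hpos _).le hm.ne'] using h2

theorem maxDet_center_lt {m n : ℕ} (hm : 0 < m) (hn : 0 < n) {H : Matrix (Fin m) (Fin n) ℝ}
    (hHst : ColumnStochastic H) (hH : secondOrderCone m ⊆ cone H) {ω : Fin m → ℝ}
    (hω : ∑ i, ω i = 1) (hne : ω ≠ (m : ℝ)⁻¹ • 1) :
    maxDet H ((m : ℝ)⁻¹ • 1) < maxDet H ω := by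
  refine (maxDet_center_le hm hH).trans_lt ?_
  by_cases hpos : ∀ i, 0 < ω i
  -- Rescaling the columns of the identity yields the determinant `∏ (ω i)⁻¹`.
  · have h := le_maxDet_of_pos (H := H) (ω := ω) (G := 1)
      (fun k j => by simpa [Matrix.one_apply] using hHst.nonneg k j)
      (fun k => by simpa [Matrix.one_apply] using hpos k)
    refine lt_of_lt_of_le ?_ h
    have hprod : 0 < ∏ i, ω i := Finset.prod_pos fun i _ => hpos i
    have hlt := prod_lt_of_sum_eq_one hm hω hpos hne
    simp only [Matrix.det_one, abs_one, one_mul, Matrix.one_apply, mul_ite, mul_one, mul_zero,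
      Finset.sum_ite_eq', Finset.mem_univ, if_true, Finset.prod_inv_distrib]
    refine (ENNReal.ofReal_lt_ofReal_iff (inv_pos.2 hprod)).2 ?_
    rw [inv_pow] at hlt
    exact (lt_inv_comm₀ (by positivity) hprod).2 hlt
  · push Not at hpos
    obtain ⟨k, hk⟩ := hpos
    -- If `ω k ≤ 0`, then `e_k` is a direction forcing `∞`, as `H` is nonnegative.
    rw [maxDet_eq_top (d := Pi.single k 1) hm hn hHst hω (by simp)
      (fun j => by simpa [Pi.single_apply] using hHst.nonneg k j)
      (by simpa [Pi.single_apply] using hk)]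
    exact ENNReal.ofReal_lt_top

/-! ### Transfer back to `V` -/

theorem V_properties {s n : ℕ} (hn : 0 < n) {P : Matrix (Fin s) (Fin (s + 1)) ℝ}
    {H : Matrix (Fin (s + 1)) (Fin n) ℝ} (hP : AffineIndependent ℝ P.col)
    (hH : ColumnStochastic H) (hsoc : secondOrderCone (s + 1) ⊆ cone H) :
    ConvexOn ℝ≥0 Set.univ (fun w : Fin s → ℝ => V (r := s + 1) (P * H) w) ∧
    (∀ w : Fin s → ℝ, V (r := s + 1) (P * H) w = ∞ ↔ w ∉ interior (conv (P * H))) ∧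
    (∀ w : Fin s → ℝ, w ≠ ((s + 1 : ℕ) : ℝ)⁻¹ • (P *ᵥ 1) →
      V (r := s + 1) (P * H) (((s + 1 : ℕ) : ℝ)⁻¹ • (P *ᵥ 1)) < V (r := s + 1) (P * H) w) := by
  obtain ⟨c, hc0, hctop, hV⟩ := exists_V_eq_mul_maxDet hP hH
  refine ⟨⟨convex_univ, ?_⟩, fun w => ⟨fun h hw => V_ne_top_of_mem_interior hw h, fun hw => ?_⟩,
    fun w hw => ?_⟩
  · intro w₁ _ w₂ _ a b _ _ hab
    obtain ⟨ω₁, hω₁, rfl⟩ := exists_barycentric hP w₁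
    obtain ⟨ω₂, hω₂, rfl⟩ := exists_barycentric hP w₂
    have hω : ∑ i, ((a : ℝ) • ω₁ + (b : ℝ) • ω₂) i = 1 := by
      simp only [Pi.add_apply, Pi.smul_apply, smul_eq_mul, Finset.sum_add_distrib,
        ← Finset.mul_sum, hω₁, hω₂, mul_one]
      rw [← NNReal.coe_add, hab, NNReal.coe_one]
    have hcomb : a • (P *ᵥ ω₁) + b • (P *ᵥ ω₂) = P *ᵥ ((a : ℝ) • ω₁ + (b : ℝ) • ω₂) := by
      rw [Matrix.mulVec_add, Matrix.mulVec_smul, Matrix.mulVec_smul]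
      rfl
    simp only [hcomb, hV _ hω, hV _ hω₁, hV _ hω₂, ENNReal.smul_def, smul_eq_mul]
    calc c * maxDet H ((a : ℝ) • ω₁ + (b : ℝ) • ω₂)
        ≤ c * (a * maxDet H ω₁ + b * maxDet H ω₂) := by
          gcongr
          exact maxDet_convex s.succ_pos hn hH hω₁ hω₂ hab
      _ = a * (c * maxDet H ω₁) + b * (c * maxDet H ω₂) := by ring
  · obtain ⟨ω, hω, rfl⟩ := exists_barycentric hP w
    obtain ⟨d, hd, hdH, hdω⟩ := exists_recession_of_notMem_interior hn hP hH hω hw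
    rw [hV ω hω, maxDet_eq_top s.succ_pos hn hH hω hd hdH hdω, ENNReal.mul_top hc0]
  · obtain ⟨ω, hω, rfl⟩ := exists_barycentric hP w
    have hs : ((s + 1 : ℕ) : ℝ) ≠ 0 := by positivity
    rw [← Matrix.mulVec_smul] at hw ⊢
    rw [hV ω hω, hV _ (by simp; field_simp)]
    exact ENNReal.mul_lt_mul_right hc0 hctop
      (maxDet_center_lt s.succ_pos hn hH hsoc hω fun h => hw (congrArg _ h))

end DualVolume

/-- Convexity of the `[0, ∞]`-valued function `V` is `ConvexOn` over the scalars `ℝ≥0`: for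
`a, b ≥ 0` with `a + b = 1`, `V (a x + b y) ≤ a V x + b V y` in `[0, ∞]`, where `0 * ∞ = 0`. -/
theorem mainTheorem4 (r n : ℕ) (hr : 1 ≤ r) (hn : r ≤ n)
    (Y : Matrix (Fin (r - 1)) (Fin n) ℝ)
    (P : Matrix (Fin (r - 1)) (Fin r) ℝ) (H : Matrix (Fin r) (Fin n) ℝ)
    (hY : Y = P * H)
    (hPrank : P.rank = r - 1) (hPaff : AffineIndependent ℝ P.col)
    (hHssc : DualVolume.SSC H) (hHstoch : DualVolume.ColumnStochastic H) :
    ConvexOn ℝ≥0 Set.univ (fun w : Fin (r - 1) → ℝ => DualVolume.V Y w) ∧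
    (∀ w : Fin (r - 1) → ℝ, DualVolume.V Y w = ∞ ↔ w ∉ interior (DualVolume.conv Y)) ∧
    (∀ w : Fin (r - 1) → ℝ, w ≠ (r : ℝ)⁻¹ • (P *ᵥ 1) →
      DualVolume.V Y ((r : ℝ)⁻¹ • (P *ᵥ 1)) < DualVolume.V Y w) := by
  subst hY
  obtain ⟨s, rfl⟩ : ∃ s, r = s + 1 := ⟨r - 1, by omega⟩
  exact DualVolume.V_properties (by omega) hPaff hHstoch hHssc.secondOrderCone_subset
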